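/- Let $N$ be a positive integer, $V_N=\{0,\dots,N-1\}$, and let $\mathscr G_N$ be the set of simple graphs $g$ on the vertex set $V_N$ that contain all the ground edges $\{x,x+1\}$, $x,x+1\in V_N$. Write $d_g$ for the graph distance of $g$ and, for $p\in[1,\infty]$, let $$\mathcal H_p(g)=\Big(\frac1{N^2}\sum_{x,y\in V_N}d_g(x,y)^p\Big)^{1/p}\ \ (p<\infty),\qquad \mathcal H_\infty(g)=\max_{x,y\in V_N}d_g(x,y).$$ For $\gamma\in(0,\infty)$ let $\mathbb P_\gamma$ be the law on $\mathscr G_N$ of the random graph $\mathcal G_N$ in which the edges $e=\{x,y\}$ of length $|e|=|y-x|>1$ are present independently of each other, each with probability $\exp(-|e|^\gamma)$. For $b\in\mathbb R$ and $p\in[1,\infty]$ let $\mathbb P^{b,p}_\gamma$ be the Gibbs probability measure on $\mathscr G_N$ given by $$\mathbb P^{b,p}_\gamma[\mathcal G_N=g]=\frac1{Z^{b,p}_{\gamma,N}}\exp\big(-N^b\,\mathcal H_p(g)\big)\,\mathbb P_\gamma[\mathcal G_N=g],$$ where $Z^{b,p}_{\gamma,N}$ is the normalizing constant, that is, the expectation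 of $\exp(-N^b\mathcal H_p(\mathcal G_N))$ under $\mathbb P_\gamma$. For $\gamma\in(0,\infty)\setminus\{1\}$ and $b\in\mathbb R$ put $$\alpha(\gamma,b)=\begin{cases}\big(\frac{1-b}{2-\gamma}\wedge1\big)\vee0&\text{if }\gamma<1,\\[4pt]\big(\frac{\gamma-b}{\gamma}\wedge1\big)\vee0&\text{if }\gamma>1.\end{cases}$$ Theorem. For every $\gamma\in(0,\infty)$ with $\gamma\neq1$, every $b\in\mathbb R$, every $p\in[1,\infty]$ and every $\varepsilon>0$, $$\lim_{N\to\infty}\mathbb P^{b,p}_\gamma\left[\left|\frac{\log\mathcal H_p(\mathcal G_N)}{\log N}-\alpha(\gamma,b)\right|>\varepsilon\right]=0.$$ -/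

import Mathlib

open scoped ENNReal unitInterval

namespace SpatialGibbs

/-- The graphs on the vertex set `{0, …, N - 1}` that contain every ground edge `{x, x + 1}`. -/
def GroundedGraph (N : ℕ) : Type :=
  {G : SimpleGraph (Fin N) // SimpleGraph.pathGraph N ≤ G}

/-- The (finite) set of graphs carries the discrete sigma-algebra. -/
instance (N : ℕ) : MeasurableSpace (GroundedGraph N) := ⊤

instance (N : ℕ) : DiscreteMeasurableSpace (GroundedGraph N) := ⟨fun _ => trivial⟩

instance (N : ℕ) : Finite (GroundedGraph N) :=
  inferInstanceAs (Finite {G : SimpleGraph (Fin N) // SimpleGraph.pathGraph N ≤ G})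

/-- The graph distance `d_g(x, y)`. As every grounded graph is connected, it is the length of a
shortest walk from `x` to `y`. -/
noncomputable def gdist {N : ℕ} (g : GroundedGraph N) (x y : Fin N) : ℕ :=
  g.1.dist x y

/-- The `ℓ^p`-average path length
`H_p(g) = (N⁻² ∑_{x,y} d_g(x,y)^p)^(1/p)`, and the diameter of `g` when `p = ∞`. -/
noncomputable def avgPathLength {N : ℕ} (p : ℝ≥0∞) (g : GroundedGraph N) : ℝ :=
  if p = ∞ then ⨆ xy : Fin N × Fin N, (gdist g xy.1 xy.2 : ℝ)
  else (1 / (N : ℝ) ^ 2 * ∑ x : Fin N, ∑ y : Fin N, (gdist g x y : ℝ) ^ p.toReal) ^ (1 / p.toReal)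

/-- The unordered pairs `{x, y}` of vertices with `|y - x| > 1`, each one represented by the ordered
pair `(x, y)` with `x < y`. -/
abbrev LongEdge (N : ℕ) : Type :=
  {e : Fin N × Fin N // (e.1 : ℕ) + 1 < (e.2 : ℕ)}

/-- The length `|e| = |y - x|` of the edge `e = {x, y}`. -/
def LongEdge.length {N : ℕ} (e : LongEdge N) : ℕ :=
  (e.1.2 : ℕ) - (e.1.1 : ℕ)

/-- The probability `exp (-|e|^γ)` that the edge `e` is present under the reference measure. -/
noncomputable def edgeProb {N : ℕ} (γ : ℝ) (e : LongEdge N) : I :=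
  ⟨Real.exp (-((e.length : ℝ) ^ γ)), Real.exp_nonneg _,
    Real.exp_le_one_iff.mpr (neg_nonpos.mpr (Real.rpow_nonneg (Nat.cast_nonneg _) _))⟩

/-- The grounded graph whose long edges are exactly the `e` with `ω e = true`. -/
def ofConfig {N : ℕ} (ω : LongEdge N → Bool) : GroundedGraph N :=
  ⟨SimpleGraph.pathGraph N ⊔
    SimpleGraph.fromRel (fun x y => ∃ h : (x : ℕ) + 1 < (y : ℕ), ω ⟨(x, y), h⟩ = true),
    le_sup_left⟩

/-- The reference measure `P_γ` on the grounded graphs with `N` vertices: the long edges `e` are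
present independently of each other, with respective probabilities `exp (-|e|^γ)`. -/
noncomputable def refMeasure (γ : ℝ) (N : ℕ) : MeasureTheory.Measure (GroundedGraph N) :=
  (MeasureTheory.Measure.pi fun e : LongEdge N =>
    ProbabilityTheory.bernoulliMeasure true false (edgeProb γ e)).map ofConfig

instance (γ : ℝ) (N : ℕ) : MeasureTheory.IsProbabilityMeasure (refMeasure γ N) :=
  MeasureTheory.Measure.isProbabilityMeasure_map (Measurable.of_discrete).aemeasurable

/-- The Gibbs measure `P^{b,p}_γ`: the probability measure on the grounded graphs with `N` vertices
whose density with respect to the reference measure is `g ↦ exp (-N^b H_p(g)) / Z`, where `Z` is the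
integral of `g ↦ exp (-N^b H_p(g))` against the reference measure. -/
noncomputable def gibbsMeasure (γ b : ℝ) (p : ℝ≥0∞) (N : ℕ) :
    MeasureTheory.Measure (GroundedGraph N) :=
  (refMeasure γ N).tilted fun g => -((N : ℝ) ^ b * avgPathLength p g)

instance (γ b : ℝ) (p : ℝ≥0∞) (N : ℕ) :
    MeasureTheory.IsProbabilityMeasure (gibbsMeasure γ b p N) :=
  MeasureTheory.isProbabilityMeasure_tilted MeasureTheory.Integrable.of_finite

/-- The exponent `α(γ, b)` (for `γ ≠ 1`). -/
noncomputable def alpha (γ b : ℝ) : ℝ :=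
  if γ < 1 then max (min ((1 - b) / (2 - γ)) 1) 0 else max (min ((γ - b) / γ) 1) 0

end SpatialGibbs

/-! The proof is a large-deviation estimate: up to logarithms in the exponent, an average path
length of order `N ^ a` costs `exp (-N ^ costExponent γ a)` under the reference measure, while the
Gibbs weight contributes `exp (-N ^ (b + a))`. The exponent `alpha γ b` is the point where the two
powers balance, truncated to `[0, 1]`.

Upper tail: forcing a hierarchy of dyadic edges makes the diameter of order `N ^ a` up to a
logarithm. For `γ < 1` the levels run from length about `N ^ a` to the top; for `γ > 1` they run
from the ground to length about `N ^ (1 - a)`. With `a = alpha γ b` this bounds the normalizing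
constant from below (`eventually_exp_le_partition`), so that the weight of much larger path lengths
is negligible (`tendsto_gibbs_upper`).

Lower tail: a small average distance yields a ball of small radius containing half of the vertices.
By `ball_card_le` such a ball requires many long edges, in the sense that `∑ |e| ^ γ` is at least of
order `N ^ κ` for any `κ < costExponent γ a` (`eventually_cost_ge`). An exponential moment bound
(`edgeLaw_cost_le`) makes this unlikely. Since `costExponent γ` is strictly decreasing, going below
`alpha γ b` makes this probability beat the reciprocal of the normalizing constant
(`tendsto_gibbs_lower`). The power mean inequality reduces the lower bounds for every `p` to `p =
1`, and the diameter serves for the upper bounds. -/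

namespace SpatialGibbs

/-! ### Deterministic bound on the size of balls -/

/-- The number of ground edges below `v` whose left end point is outside `U`. -/
def uncovered (U : Finset ℕ) (v : ℕ) : ℕ := ((Finset.range v).filter (· ∉ U)).card

lemma uncovered_mono (U : Finset ℕ) {v w : ℕ} (h : v ≤ w) : uncovered U v ≤ uncovered U w :=
  Finset.card_le_card (Finset.filter_subset_filter _ (Finset.range_subset_range.2 h))

lemma uncovered_succ (U : Finset ℕ) (v : ℕ) :
    uncovered U (v + 1) = uncovered U v + if v ∈ U then 0 else 1 := by
  unfold uncovered
  rw [Finset.range_add_one, Finset.filter_insert]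
  split_ifs <;> simp_all

lemma uncovered_le_add (U : Finset ℕ) (v k : ℕ) : uncovered U (v + k) ≤ uncovered U v + k := by
  induction k with
  | zero => simp
  | succ k ih =>
    rw [← add_assoc, uncovered_succ]
    split_ifs <;> omega

lemma uncovered_eq_of_subset (U : Finset ℕ) (v k : ℕ) (h : Finset.Ico v (v + k) ⊆ U) :
    uncovered U (v + k) = uncovered U v := by
  induction k with
  | zero => simp
  | succ k ih =>
    rw [← add_assoc, uncovered_succ, if_pos (h (by simp)),
      ih ((Finset.Ico_subset_Ico_right (by omega)).trans h), add_zero]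

lemma uncovered_lt (U : Finset ℕ) {v w : ℕ} (h : v < w) (hv : v ∉ U) :
    uncovered U v < uncovered U w := by
  have := uncovered_mono U (Nat.succ_le_of_lt h)
  rw [Nat.succ_eq_add_one, uncovered_succ, if_neg hv] at this
  omega

lemma ofConfig_adj {N : ℕ} (ω : LongEdge N → Bool) (x y : Fin N) :
    (ofConfig ω).1.Adj x y ↔ ((x : ℕ) + 1 = y ∨ (y : ℕ) + 1 = x) ∨
      ∃ e : LongEdge N, ω e = true ∧ (e.1 = (x, y) ∨ e.1 = (y, x)) := by
  unfold ofConfig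
  simp only [SimpleGraph.sup_adj, SimpleGraph.pathGraph_adj, SimpleGraph.fromRel_adj]
  apply or_congr Iff.rfl
  constructor
  · rintro ⟨-, ⟨h, hω⟩ | ⟨h, hω⟩⟩
    · exact ⟨_, hω, Or.inl rfl⟩
    · exact ⟨_, hω, Or.inr rfl⟩
  · rintro ⟨⟨e, he⟩, hω, h | h⟩ <;> dsimp only at h <;> subst h
    · exact ⟨fun h => by subst h; simp at he, Or.inl ⟨he, hω⟩⟩
    · exact ⟨fun h => by subst h; simp at he, Or.inr ⟨he, hω⟩⟩

lemma GroundedGraph.connected {N : ℕ} (g : GroundedGraph N) (hN : 0 < N) : g.1.Connected := by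
  obtain ⟨n, rfl⟩ := Nat.exists_eq_succ_of_ne_zero hN.ne'
  exact (SimpleGraph.pathGraph_connected n).mono g.2

lemma exists_walk_gdist {N : ℕ} (g : GroundedGraph N) (x y : Fin N) :
    ∃ w : g.1.Walk x y, w.length = gdist g x y :=
  (g.connected x.pos).exists_walk_length_eq_dist x y

/-- A function that varies by at most `R` along each edge which avoids `Z` varies by at most
`R` times the distance to the set `Z`. -/
lemma exists_near_of_walk {V : Type*} (G : SimpleGraph V) (f : V → ℝ) (Z : Set V) (R : ℝ)
    (hR : 0 ≤ R) (hf : ∀ x y, G.Adj x y → x ∉ Z → |f x - f y| ≤ R) {x y : V} (hx : x ∈ Z)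
    (w : G.Walk y x) : ∃ z ∈ Z, |f y - f z| ≤ w.length * R := by
  induction w with
  | nil => exact ⟨_, hx, by simp⟩
  | @cons u v w' h p ih =>
    by_cases hu : u ∈ Z
    · exact ⟨u, hu, by simpa using by positivity⟩
    · obtain ⟨z, hz, hvz⟩ := ih hx
      refine ⟨z, hz, (abs_sub_le _ (f v) _).trans ?_⟩
      have := hf u v h hu
      push_cast [SimpleGraph.Walk.length_cons]
      linarith

/-- The present edges with length in `[R, S)`. -/
noncomputable def edgesBetween {N : ℕ} (ω : LongEdge N → Bool) (R S : ℝ) : Finset (LongEdge N) :=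
  Finset.univ.filter fun e => ω e = true ∧ R ≤ e.length ∧ (e.length : ℝ) < S

/-- The present edges with length at least `R`. -/
noncomputable def edgesFrom {N : ℕ} (ω : LongEdge N → Bool) (R : ℝ) : Finset (LongEdge N) :=
  Finset.univ.filter fun e => ω e = true ∧ R ≤ e.length

/-- The left end points of the ground edges below some present edge with length in `[R, S)`. -/
noncomputable def coveredBy {N : ℕ} (ω : LongEdge N → Bool) (R S : ℝ) : Finset ℕ :=
  (edgesBetween ω R S).biUnion fun e => Finset.Ico (e.1.1 : ℕ) (e.1.2 : ℕ)

lemma card_coveredBy_le {N : ℕ} (ω : LongEdge N → Bool) (R S : ℝ) :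
    ((coveredBy ω R S).card : ℝ) ≤ ∑ e ∈ edgesBetween ω R S, (e.length : ℝ) := by
  have : (coveredBy ω R S).card ≤ ∑ e ∈ edgesBetween ω R S, e.length := by
    refine Finset.card_biUnion_le.trans (Finset.sum_le_sum fun e _ => ?_)
    simp [LongEdge.length]
  exact_mod_cast this

/-- Covering contracts the edges of intermediate length: every ground edge below one with length in
`[R, S)` is covered, so `uncovered` takes the same value at both ends. A shorter edge changes it by
at most its length, and edges of length at least `S` are excluded because `x` is an end point of
none. -/
lemma abs_uncovered_sub_le {N : ℕ} (ω : LongEdge N → Bool) (R S : ℝ) (hR : 1 ≤ R) (x y : Fin N)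
    (h : (ofConfig ω).1.Adj x y)
    (hx : ∀ e ∈ edgesFrom ω S, e.1.1 ≠ x ∧ e.1.2 ≠ x) :
    |(uncovered (coveredBy ω R S) x : ℝ) - uncovered (coveredBy ω R S) y| ≤ R := by
  set U := coveredBy ω R S
  have key : ∀ e : LongEdge N, ω e = true → (e.length : ℝ) < S →
      |(uncovered U e.1.1 : ℝ) - uncovered U e.1.2| ≤ R := by
    intro e he hS
    have hlt := e.2
    obtain ⟨k, hk⟩ := Nat.exists_eq_add_of_le (show (e.1.1 : ℕ) ≤ e.1.2 by omega)
    have hlen : e.length = k := by simp [LongEdge.length, hk]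
    by_cases hRe : R ≤ e.length
    · have hsub : Finset.Ico (e.1.1 : ℕ) (e.1.1 + k) ⊆ U := by
        rw [← hk]
        exact Finset.subset_biUnion_of_mem (fun e : LongEdge N => Finset.Ico (e.1.1 : ℕ) e.1.2)
          (by simp [edgesBetween, he, hRe, hS])
      rw [hk, uncovered_eq_of_subset U _ _ hsub]
      simp; linarith
    · push Not at hRe
      rw [hlen] at hRe
      have h1 := uncovered_mono U (show (e.1.1 : ℕ) ≤ e.1.1 + k by omega)
      have h2 := uncovered_le_add U e.1.1 k
      rw [hk]
      have h1' : (uncovered U e.1.1 : ℝ) ≤ uncovered U (e.1.1 + k) := by exact_mod_cast h1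
      have h2' : (uncovered U (e.1.1 + k) : ℝ) ≤ uncovered U e.1.1 + k := by exact_mod_cast h2
      rw [abs_le]; constructor <;> linarith
  have keyg : ∀ v : ℕ, |(uncovered U v : ℝ) - uncovered U (v + 1)| ≤ R := by
    intro v
    rw [uncovered_succ]
    split_ifs <;> simp <;> linarith
  rw [ofConfig_adj] at h
  rcases h with (h | h) | ⟨e, he, h | h⟩
  · rw [← h]; exact keyg _
  · rw [← h, abs_sub_comm]; exact keyg _
  · have h1 : e.1.1 = x := by rw [h]
    have h2 : e.1.2 = y := by rw [h]
    have hS : (e.length : ℝ) < S := by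
      by_contra hS
      exact (hx e (by simp [edgesFrom, he, not_lt.1 hS])).1 h1
    rw [← h1, ← h2]; exact key e he hS
  · have h1 : e.1.1 = y := by rw [h]
    have h2 : e.1.2 = x := by rw [h]
    have hS : (e.length : ℝ) < S := by
      by_contra hS
      exact (hx e (by simp [edgesFrom, he, not_lt.1 hS])).2 h2
    rw [← h1, ← h2, abs_sub_comm]; exact key e he hS

lemma card_nat_le_of_abs_sub_le (s : Finset ℕ) (a : ℕ) (t : ℝ) (ht : 0 ≤ t)
    (h : ∀ k ∈ s, |(k : ℝ) - a| ≤ t) : (s.card : ℝ) ≤ 2 * t + 1 := by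
  have hsub : s ⊆ Finset.Icc (a - ⌊t⌋₊) (a + ⌊t⌋₊) := by
    intro k hk
    have h1 := abs_le.1 (h k hk)
    rw [Finset.mem_Icc]
    rcases le_total k a with hka | hka
    · have : a - k ≤ ⌊t⌋₊ := Nat.le_floor (by rw [Nat.cast_sub hka]; linarith)
      omega
    · have : k - a ≤ ⌊t⌋₊ := Nat.le_floor (by rw [Nat.cast_sub hka]; linarith)
      omega
  have h2 : s.card ≤ 2 * ⌊t⌋₊ + 1 := by
    refine (Finset.card_le_card hsub).trans ?_
    simp only [Nat.card_Icc]; omega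
  have h3 : (s.card : ℝ) ≤ 2 * (⌊t⌋₊ : ℝ) + 1 := by exact_mod_cast h2
  linarith [Nat.floor_le ht]

/-- A ball of radius `n` in the graph distance is small unless long edges are numerous. -/
lemma ball_card_le {N : ℕ} (ω : LongEdge N → Bool) (R S n : ℝ) (hR : 1 ≤ R) (hn : 0 ≤ n)
    (x : Fin N) :
    ((Finset.univ.filter fun y => (gdist (ofConfig ω) x y : ℝ) ≤ n).card : ℝ) ≤
      ∑ e ∈ edgesBetween ω R S, (e.length : ℝ) +
        (2 * (edgesFrom ω S).card + 1) * (2 * (n * R) + 1) := by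
  classical
  set U := coveredBy ω R S with hU
  set B := Finset.univ.filter fun y => (gdist (ofConfig ω) x y : ℝ) ≤ n with hB
  -- A walk from `y` to `x`, stopped when it first meets `Z`, uses no edge of length at least `S`.
  -- The ball is thus controlled by at most `2m + 1` centres, with `m` the number of such edges.
  set Z : Finset (Fin N) := insert x
    ((edgesFrom ω S).image (fun e => e.1.1) ∪ (edgesFrom ω S).image (fun e => e.1.2)) with hZ
  have hZcard : (Z.card : ℝ) ≤ 2 * (edgesFrom ω S).card + 1 := by
    have h1 : Z.card ≤ 2 * (edgesFrom ω S).card + 1 := by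
      refine (Finset.card_insert_le _ _).trans ?_
      refine Nat.succ_le_succ ((Finset.card_union_le _ _).trans ?_)
      have h1 := Finset.card_image_le (s := edgesFrom ω S) (f := fun e => e.1.1)
      have h2 := Finset.card_image_le (s := edgesFrom ω S) (f := fun e => e.1.2)
      omega
    exact_mod_cast h1
  have hnear : ∀ y ∈ B, ∃ z ∈ Z, |(uncovered U y : ℝ) - uncovered U z| ≤ n * R := by
    intro y hy
    obtain ⟨w, hw⟩ := exists_walk_gdist (ofConfig ω) x y
    obtain ⟨z, hz, hyz⟩ := exists_near_of_walk (ofConfig ω).1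
      (fun v : Fin N => (uncovered U v : ℝ)) (Z : Set (Fin N)) R (by linarith)
      (fun u v huv hu => abs_uncovered_sub_le ω R S hR u v huv (fun e he => by
        rw [hZ] at hu
        simp only [Finset.coe_insert, Set.mem_insert_iff, Finset.mem_coe, Finset.mem_union,
          Finset.mem_image, not_or, not_exists, not_and] at hu
        exact ⟨hu.2.1 e he, hu.2.2 e he⟩))
      (show x ∈ (Z : Set (Fin N)) by simp [hZ]) w.reverse
    refine ⟨z, hz, hyz.trans ?_⟩
    rw [SimpleGraph.Walk.length_reverse, hw]
    have : (gdist (ofConfig ω) x y : ℝ) ≤ n := by simpa [hB] using hy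
    gcongr
  have hsplit : (B.card : ℝ) = (B.filter fun y : Fin N => (y : ℕ) ∈ U).card +
      (B.filter fun y : Fin N => (y : ℕ) ∉ U).card := by
    exact_mod_cast (Finset.card_filter_add_card_filter_not _).symm
  have hin : ((B.filter fun y : Fin N => (y : ℕ) ∈ U).card : ℝ) ≤ U.card := by
    have : (B.filter fun y : Fin N => (y : ℕ) ∈ U).card ≤ U.card :=
      Finset.card_le_card_of_injOn (fun y : Fin N => (y : ℕ)) (fun y hy => by
        simpa using (Finset.mem_filter.1 hy).2) (fun a _ b _ h => Fin.ext h)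
    exact_mod_cast this
  -- Off `U` the function `uncovered U` is injective, so vertices are counted through its integer
  -- values, which lie within `n * R` of its value at some centre.
  have hout : ((B.filter fun y : Fin N => (y : ℕ) ∉ U).card : ℝ) ≤ Z.card * (2 * (n * R) + 1) := by
    set B' := B.filter fun y : Fin N => (y : ℕ) ∉ U
    set J := B'.image fun y : Fin N => uncovered U y
    have hinj : B'.card = J.card := by
      refine (Finset.card_image_of_injOn ?_).symm
      intro a ha b hb hab
      have ha' := (Finset.mem_filter.1 ha).2
      have hb' := (Finset.mem_filter.1 hb).2
      rcases lt_trichotomy (a : ℕ) b with h | h | h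
      · exact absurd hab (uncovered_lt U h ha').ne
      · exact Fin.ext h
      · exact absurd hab (uncovered_lt U h hb').ne'
    have hJ : J = Z.biUnion fun z =>
        J.filter fun k : ℕ => |(k : ℝ) - uncovered U z| ≤ n * R := by
      ext k
      simp only [Finset.mem_biUnion, Finset.mem_filter]
      constructor
      · intro hk
        obtain ⟨y, hy, rfl⟩ := Finset.mem_image.1 hk
        obtain ⟨z, hz, h⟩ := hnear y (Finset.mem_filter.1 hy).1
        exact ⟨z, hz, hk, h⟩
      · rintro ⟨_, _, h, _⟩
        exact h
    rw [hinj, hJ]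
    calc ((Z.biUnion fun z => J.filter fun k : ℕ => |(k : ℝ) - uncovered U z| ≤ n * R).card : ℝ)
        ≤ ∑ z ∈ Z, ((J.filter fun k : ℕ => |(k : ℝ) - uncovered U z| ≤ n * R).card : ℝ) := by
          exact_mod_cast Finset.card_biUnion_le
      _ ≤ ∑ z ∈ Z, (2 * (n * R) + 1) := Finset.sum_le_sum fun z _ =>
          card_nat_le_of_abs_sub_le _ (uncovered U z) _ (by positivity)
            fun k hk => (Finset.mem_filter.1 hk).2
      _ = _ := by rw [Finset.sum_const, nsmul_eq_mul]
  rw [hsplit]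
  refine add_le_add (hin.trans (card_coveredBy_le ω R S)) (hout.trans ?_)
  gcongr

/-- If the average distance is at most `h`, some ball of radius `2h` contains half of all
vertices. -/
lemma exists_half_ball {N : ℕ} (hN : 0 < N) (g : GroundedGraph N) (h : ℝ) (hh : 0 < h)
    (hsum : ∑ x : Fin N, ∑ y : Fin N, (gdist g x y : ℝ) ≤ (N : ℝ) ^ 2 * h) :
    ∃ x : Fin N, (N : ℝ) / 2 ≤
      ((Finset.univ.filter fun y => (gdist g x y : ℝ) ≤ 2 * h).card : ℝ) := by
  have : Nonempty (Fin N) := ⟨⟨0, hN⟩⟩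
  obtain ⟨x, -, hx⟩ := Finset.exists_le_of_sum_le (s := (Finset.univ : Finset (Fin N)))
    (f := fun x => ∑ y : Fin N, (gdist g x y : ℝ)) (g := fun _ => (N : ℝ) * h)
    Finset.univ_nonempty (by simpa [pow_two, mul_assoc] using hsum)
  refine ⟨x, ?_⟩
  have hsplit : (N : ℝ) = (Finset.univ.filter fun y => (gdist g x y : ℝ) ≤ 2 * h).card +
      (Finset.univ.filter fun y => ¬ (gdist g x y : ℝ) ≤ 2 * h).card := by
    have := Finset.card_filter_add_card_filter_not (s := (Finset.univ : Finset (Fin N)))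
      (fun y => (gdist g x y : ℝ) ≤ 2 * h)
    rw [Finset.card_univ, Fintype.card_fin] at this
    exact_mod_cast this.symm
  have hfar : ((Finset.univ.filter fun y => ¬ (gdist g x y : ℝ) ≤ 2 * h).card : ℝ) * (2 * h) ≤
      N * h := by
    refine le_trans ?_ hx
    rw [← nsmul_eq_mul]
    refine (Finset.card_nsmul_le_sum _ (fun y => (gdist g x y : ℝ)) _ fun y hy => ?_).trans
      (Finset.sum_le_sum_of_subset_of_nonneg (Finset.filter_subset _ _) fun _ _ _ => by positivity)
    exact (not_le.1 (Finset.mem_filter.1 hy).2).le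
  have : ((Finset.univ.filter fun y => ¬ (gdist g x y : ℝ) ≤ 2 * h).card : ℝ) ≤ N / 2 := by
    nlinarith
  linarith

/-! ### Dyadic edges, their cost and the distances they produce -/

/-- The edges of length `2 ^ k` whose end points are multiples of `2 ^ k`. -/
def dyadicLevel (N k : ℕ) : Finset (LongEdge N) :=
  Finset.univ.filter fun e => e.length = 2 ^ k ∧ 2 ^ k ∣ (e.1.1 : ℕ)

/-- The dyadic edges of levels `K₁, …, K₂`. -/
def dyadicEdges (N K₁ K₂ : ℕ) : Finset (LongEdge N) :=
  (Finset.Icc K₁ K₂).biUnion (dyadicLevel N)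

lemma card_dyadicLevel_le (N k : ℕ) : (dyadicLevel N k).card ≤ N / 2 ^ k := by
  have hpos : 0 < 2 ^ k := by positivity
  have : (dyadicLevel N k).card ≤ (Finset.range (N / 2 ^ k)).card := by
    refine Finset.card_le_card_of_injOn (fun e => (e.1.1 : ℕ) / 2 ^ k) (fun e he => ?_) ?_
    · obtain ⟨h1, j, hj⟩ := (Finset.mem_filter.1 he).2
      have h2 := e.1.2.2
      have h3 := e.2
      unfold LongEdge.length at h1
      simp only [Finset.coe_range, Set.mem_Iio]
      rw [hj, Nat.mul_div_cancel_left _ hpos, ← Nat.succ_le_iff, Nat.le_div_iff_mul_le hpos,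
        Nat.succ_mul, mul_comm]
      omega
    · intro a ha b hb hab
      obtain ⟨ha1, ha2⟩ := (Finset.mem_filter.1 ha).2
      obtain ⟨hb1, hb2⟩ := (Finset.mem_filter.1 hb).2
      have h := a.2
      have h' := b.2
      unfold LongEdge.length at ha1 hb1
      have hab' : (a.1.1 : ℕ) = b.1.1 := by
        rw [← Nat.div_mul_cancel ha2, ← Nat.div_mul_cancel hb2]
        exact congrArg (· * 2 ^ k) hab
      exact Subtype.ext (Prod.ext (Fin.ext hab') (Fin.ext (by omega)))
  simpa using this

/-- Level `k` has at most `N / 2 ^ k` edges, each of cost `(2 ^ k) ^ γ`, hence costs at most `N * (2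
^ k) ^ (γ - 1)`. -/
lemma sum_dyadicEdges_le (N K₁ K₂ : ℕ) (γ B : ℝ) (hK : K₁ ≤ K₂)
    (hB : ∀ k, K₁ ≤ k → k ≤ K₂ → ((2 : ℝ) ^ k) ^ (γ - 1) ≤ B) :
    ∑ e ∈ dyadicEdges N K₁ K₂, (e.length : ℝ) ^ γ ≤ (K₂ + 1) * (N * B) := by
  unfold dyadicEdges
  rw [Finset.sum_biUnion]
  · calc ∑ k ∈ Finset.Icc K₁ K₂, ∑ e ∈ dyadicLevel N k, (e.length : ℝ) ^ γ
        ≤ ∑ k ∈ Finset.Icc K₁ K₂, (N : ℝ) * B := by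
          refine Finset.sum_le_sum fun k hk => ?_
          rw [Finset.mem_Icc] at hk
          have h2 : (0 : ℝ) < 2 ^ k := by positivity
          calc ∑ e ∈ dyadicLevel N k, (e.length : ℝ) ^ γ
              = ∑ e ∈ dyadicLevel N k, ((2 : ℝ) ^ k) ^ γ := Finset.sum_congr rfl fun e he => by
                rw [(Finset.mem_filter.1 he).2.1]; push_cast; rfl
            _ = (dyadicLevel N k).card * ((2 : ℝ) ^ k) ^ γ := by
                rw [Finset.sum_const, nsmul_eq_mul]
            _ ≤ (N / 2 ^ k) * ((2 : ℝ) ^ k) ^ γ := by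
                gcongr
                refine (Nat.cast_le.2 (card_dyadicLevel_le N k)).trans ?_
                exact_mod_cast Nat.cast_div_le
            _ = N * ((2 : ℝ) ^ k) ^ (γ - 1) := by
                rw [Real.rpow_sub h2, Real.rpow_one]; ring
            _ ≤ N * B := by gcongr; exact hB k hk.1 hk.2
      _ = (K₂ + 1 - K₁ : ℕ) * (N * B) := by simp
      _ ≤ (K₂ + 1) * (N * B) := by
          have : 0 ≤ B := le_trans (by positivity) (hB K₁ le_rfl hK)
          gcongr
          have : K₂ + 1 - K₁ ≤ K₂ + 1 := by omega
          exact_mod_cast this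
  · intro k _ l _ hkl
    refine Finset.disjoint_left.2 fun e he he' => hkl ?_
    have h1 := (Finset.mem_filter.1 he).2.1
    have h2 := (Finset.mem_filter.1 he').2.1
    exact Nat.pow_right_injective le_rfl (h1.symm.trans h2)

lemma gdist_triangle {N : ℕ} (g : GroundedGraph N) (x y z : Fin N) :
    gdist g x z ≤ gdist g x y + gdist g y z :=
  (g.connected x.pos).dist_triangle

lemma gdist_comm {N : ℕ} (g : GroundedGraph N) (x y : Fin N) : gdist g x y = gdist g y x :=
  SimpleGraph.dist_comm

lemma gdist_le_one_of_adj {N : ℕ} (g : GroundedGraph N) (x y : Fin N) (h : g.1.Adj x y) :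
    gdist g x y ≤ 1 :=
  SimpleGraph.dist_le h.toWalk

/-- The ground path bounds the graph distance. -/
lemma gdist_add_le {N : ℕ} (g : GroundedGraph N) (v k : ℕ) (h : v + k < N) :
    gdist g ⟨v + k, h⟩ ⟨v, by omega⟩ ≤ k := by
  induction k with
  | zero => simp [gdist]
  | succ k ih =>
    refine (gdist_triangle g _ ⟨v + k, by omega⟩ _).trans ?_
    have h1 := ih (by omega)
    have h2 : gdist g ⟨v + (k + 1), h⟩ ⟨v + k, by omega⟩ ≤ 1 := by
      refine gdist_le_one_of_adj g _ _ (g.2 ?_)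
      rw [SimpleGraph.pathGraph_adj]
      right
      simp only; omega
    omega

lemma gdist_le {N : ℕ} (g : GroundedGraph N) (x y : Fin N) : gdist g x y ≤ N := by
  wlog h : y ≤ x generalizing x y
  · rw [gdist_comm]; exact this y x (le_of_not_ge h)
  · obtain ⟨k, hk⟩ := Nat.exists_eq_add_of_le (Fin.le_def.1 h)
    have h1 := gdist_add_le g y k (hk ▸ x.2)
    have h2 : (⟨(y : ℕ) + k, hk ▸ x.2⟩ : Fin N) = x := Fin.ext hk.symm
    rw [h2] at h1
    have := x.2
    refine h1.trans ?_
    omega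

lemma gdist_dyadic_le_one {N K₁ K₂ : ℕ} {ω : LongEdge N → Bool}
    (hω : ∀ e ∈ dyadicEdges N K₁ K₂, ω e = true) (k j : ℕ) (h1 : K₁ ≤ k) (h2 : k ≤ K₂) (h : (j + 1) * 2 ^ k < N) :
    gdist (ofConfig ω) ⟨(j + 1) * 2 ^ k, h⟩
      ⟨j * 2 ^ k, lt_of_le_of_lt (Nat.mul_le_mul_right _ (Nat.le_succ j)) h⟩ ≤ 1 := by
  refine gdist_le_one_of_adj _ _ _ ?_
  rw [ofConfig_adj]
  have hpos : 0 < 2 ^ k := by positivity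
  have hmul : (j + 1) * 2 ^ k = j * 2 ^ k + 2 ^ k := by ring
  -- At level `0` the step is a ground edge, which is not a `LongEdge`.
  rcases Nat.eq_or_lt_of_le (Nat.succ_le_of_lt hpos) with hk | hk
  · left; right; simp only; omega
  · right
    refine ⟨⟨(⟨j * 2 ^ k, by omega⟩, ⟨(j + 1) * 2 ^ k, h⟩), by simp only; omega⟩, hω _ ?_,
      Or.inr rfl⟩
    refine Finset.mem_biUnion.2 ⟨k, Finset.mem_Icc.2 ⟨h1, h2⟩, ?_⟩
    refine Finset.mem_filter.2 ⟨Finset.mem_univ _, ?_, Dvd.intro_left j rfl⟩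
    simp only [LongEdge.length]; omega

lemma gdist_top_level_le {N K₁ K₂ : ℕ} {ω : LongEdge N → Bool}
    (hω : ∀ e ∈ dyadicEdges N K₁ K₂, ω e = true) (hK : K₁ ≤ K₂) (j : ℕ) (h : j * 2 ^ K₂ < N) :
    gdist (ofConfig ω) ⟨j * 2 ^ K₂, h⟩ ⟨0, by omega⟩ ≤ j := by
  induction j with
  | zero => simp [gdist]
  | succ j ih =>
    have h' : j * 2 ^ K₂ < N := lt_of_le_of_lt (Nat.mul_le_mul_right _ (Nat.le_succ j)) h
    have h1 := ih h'
    have h2 := gdist_dyadic_le_one hω K₂ j hK le_rfl h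
    have := gdist_triangle (ofConfig ω) ⟨(j + 1) * 2 ^ K₂, h⟩ ⟨j * 2 ^ K₂, h'⟩ ⟨0, by omega⟩
    omega

/-- Climbing one level costs at most one step: an even multiple of `2 ^ k` already lies on level `k
+ 1`, and an odd one is joined to the preceding even one. At the top level at most `N / 2 ^ K₂` hops
remain. -/
lemma gdist_level_le {N K₁ K₂ : ℕ} {ω : LongEdge N → Bool}
    (hω : ∀ e ∈ dyadicEdges N K₁ K₂, ω e = true) (n k : ℕ) (hk : k + n = K₂) (hk₁ : K₁ ≤ k)
    (j : ℕ) (h : j * 2 ^ k < N) :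
    gdist (ofConfig ω) ⟨j * 2 ^ k, h⟩ ⟨0, Nat.zero_lt_of_lt h⟩ ≤ n + N / 2 ^ K₂ := by
  induction n generalizing k j with
  | zero =>
    obtain rfl : k = K₂ := by omega
    have := gdist_top_level_le hω (by omega) j h
    have h2 : j ≤ N / 2 ^ k := (Nat.le_div_iff_mul_le (by positivity)).2 h.le
    omega
  | succ n ih =>
    obtain ⟨i, hi | hi⟩ := Nat.even_or_odd' j
    · have hj : j * 2 ^ k = i * 2 ^ (k + 1) := by rw [hi, pow_succ]; ring
      have := ih (k + 1) (by omega) (by omega) i (hj ▸ h)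
      simp only [hj]
      omega
    · have hj : (2 * i) * 2 ^ k = i * 2 ^ (k + 1) := by rw [pow_succ]; ring
      subst hi
      have h' : (2 * i) * 2 ^ k < N :=
        lt_of_le_of_lt (Nat.mul_le_mul_right _ (Nat.le_succ _)) h
      have h1 := ih (k + 1) (by omega) (by omega) i (hj ▸ h')
      have h2 := gdist_dyadic_le_one hω k (2 * i) (by omega) (by omega) h
      have h3 := gdist_triangle (ofConfig ω) ⟨(2 * i + 1) * 2 ^ k, h⟩ ⟨(2 * i) * 2 ^ k, h'⟩
        ⟨0, Nat.zero_lt_of_lt h⟩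
      simp only [hj] at h3 h2
      omega

lemma gdist_zero_le {N K₁ K₂ : ℕ} {ω : LongEdge N → Bool}
    (hω : ∀ e ∈ dyadicEdges N K₁ K₂, ω e = true) (hK : K₁ ≤ K₂) (v : Fin N) :
    gdist (ofConfig ω) v ⟨0, v.pos⟩ ≤ 2 ^ K₁ + K₂ + N / 2 ^ K₂ := by
  have hmod := Nat.div_add_mod' (v : ℕ) (2 ^ K₁)
  have hlt := Nat.mod_lt (v : ℕ) (show 0 < 2 ^ K₁ by positivity)
  have hv := v.2
  have h1 := gdist_level_le hω (K₂ - K₁) K₁ (by omega) le_rfl ((v : ℕ) / 2 ^ K₁) (by omega)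
  have h2 := gdist_add_le (ofConfig ω) ((v : ℕ) / 2 ^ K₁ * 2 ^ K₁) ((v : ℕ) % 2 ^ K₁) (by omega)
  simp only [hmod] at h2
  have h3 := gdist_triangle (ofConfig ω) v ⟨(v : ℕ) / 2 ^ K₁ * 2 ^ K₁, by omega⟩ ⟨0, v.pos⟩
  simp only [Fin.eta] at h2
  omega

/-- The dyadic edges bound the diameter. -/
lemma gdist_le_of_dyadic {N K₁ K₂ : ℕ} {ω : LongEdge N → Bool}
    (hω : ∀ e ∈ dyadicEdges N K₁ K₂, ω e = true) (hK : K₁ ≤ K₂) (x y : Fin N) :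
    gdist (ofConfig ω) x y ≤ 2 * (2 ^ K₁ + K₂ + N / 2 ^ K₂) := by
  have h1 := gdist_zero_le hω hK x
  have h2 := gdist_zero_le hω hK y
  have h3 := gdist_triangle (ofConfig ω) x ⟨0, x.pos⟩ y
  rw [gdist_comm _ y] at h2
  omega


/-! ### Comparison of the average path length with the diameter and the mean distance -/

lemma avgPathLength_le {N : ℕ} (hN : 0 < N) (p : ℝ≥0∞) (hp : 1 ≤ p) (g : GroundedGraph N) (D : ℝ)
    (hD : ∀ x y, (gdist g x y : ℝ) ≤ D) : avgPathLength p g ≤ D := by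
  have : Nonempty (Fin N) := ⟨⟨0, hN⟩⟩
  have hD0 : 0 ≤ D := le_trans (by positivity) (hD ⟨0, hN⟩ ⟨0, hN⟩)
  unfold avgPathLength
  split_ifs with h
  · exact ciSup_le fun xy => hD xy.1 xy.2
  · have hp1 : 1 ≤ p.toReal := by
      rw [← ENNReal.toReal_one]; exact ENNReal.toReal_mono h hp
    have hp0 : 0 < p.toReal := by linarith
    have hN' : (0 : ℝ) < N := by exact_mod_cast hN
    calc _ ≤ (1 / (N : ℝ) ^ 2 * ∑ x : Fin N, ∑ y : Fin N, D ^ p.toReal) ^ (1 / p.toReal) := by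
          gcongr; exact hD _ _
      _ = D := by
          simp only [Finset.sum_const, Finset.card_univ, Fintype.card_fin, nsmul_eq_mul]
          rw [show 1 / (N : ℝ) ^ 2 * (N * (N * D ^ p.toReal)) = D ^ p.toReal by field_simp,
            ← Real.rpow_mul hD0, mul_one_div_cancel hp0.ne', Real.rpow_one]

lemma mean_le_avgPathLength {N : ℕ} (hN : 0 < N) (p : ℝ≥0∞) (hp : 1 ≤ p) (g : GroundedGraph N) :
    1 / (N : ℝ) ^ 2 * ∑ x : Fin N, ∑ y : Fin N, (gdist g x y : ℝ) ≤ avgPathLength p g := by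
  have hN' : (0 : ℝ) < N := by exact_mod_cast hN
  unfold avgPathLength
  split_ifs with h
  · set M := ⨆ xy : Fin N × Fin N, (gdist g xy.1 xy.2 : ℝ)
    calc _ ≤ 1 / (N : ℝ) ^ 2 * ∑ x : Fin N, ∑ y : Fin N, M := by
          gcongr with x _ y _
          exact le_ciSup (f := fun xy : Fin N × Fin N => (gdist g xy.1 xy.2 : ℝ))
            (Set.finite_range _).bddAbove (x, y)
      _ = M := by
          simp only [Finset.sum_const, Finset.card_univ, Fintype.card_fin, nsmul_eq_mul]
          field_simp
  · have hp1 : 1 ≤ p.toReal := by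
      rw [← ENNReal.toReal_one]; exact ENNReal.toReal_mono h hp
    have := Real.arith_mean_le_rpow_mean (Finset.univ : Finset (Fin N × Fin N))
      (fun _ => 1 / (N : ℝ) ^ 2) (fun xy => (gdist g xy.1 xy.2 : ℝ)) (fun _ _ => by positivity)
      (by simp; field_simp) (fun _ _ => by positivity) hp1
    rwa [← Finset.mul_sum, ← Finset.mul_sum, Fintype.sum_prod_type, Fintype.sum_prod_type] at this

/-- Distinct vertices are at distance at least one, so the mean is at least `(N - 1) / N`. This
settles the lower tail when `alpha γ b = 0` and makes the logarithm in the theorem meaningful. -/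
lemma half_le_avgPathLength {N : ℕ} (hN : 2 ≤ N) (p : ℝ≥0∞) (hp : 1 ≤ p) (g : GroundedGraph N) :
    1 / 2 ≤ avgPathLength p g := by
  refine le_trans ?_ (mean_le_avgPathLength (by omega) p hp g)
  have hN' : (2 : ℝ) ≤ N := by exact_mod_cast hN
  have hrow : ∀ x : Fin N, (N : ℝ) - 1 ≤ ∑ y : Fin N, (gdist g x y : ℝ) := by
    intro x
    calc (N : ℝ) - 1 = ∑ y ∈ Finset.univ.erase x, (1 : ℝ) := by
          rw [Finset.sum_const, Finset.card_erase_of_mem (Finset.mem_univ x), Finset.card_univ,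
            Fintype.card_fin, nsmul_eq_mul, mul_one, Nat.cast_sub (by omega), Nat.cast_one]
      _ ≤ ∑ y ∈ Finset.univ.erase x, (gdist g x y : ℝ) := by
          refine Finset.sum_le_sum fun y hy => ?_
          have : 0 < gdist g x y :=
            (g.connected x.pos).pos_dist_of_ne (Finset.ne_of_mem_erase hy).symm
          exact_mod_cast this
      _ ≤ _ := Finset.sum_le_sum_of_subset_of_nonneg (Finset.subset_univ _)
          fun _ _ _ => by positivity
  calc (1 : ℝ) / 2 ≤ 1 / (N : ℝ) ^ 2 * ∑ x : Fin N, ((N : ℝ) - 1) := by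
        simp only [Finset.sum_const, Finset.card_univ, Fintype.card_fin, nsmul_eq_mul]
        rw [div_mul_eq_mul_div, div_le_div_iff₀ (by norm_num) (by positivity)]
        nlinarith
    _ ≤ _ := by gcongr with x; exact hrow x

/-! ### Estimates for the reference and Gibbs measures -/

open MeasureTheory ProbabilityTheory

/-- The law of the configuration of the long edges. -/
noncomputable abbrev edgeLaw (γ : ℝ) (N : ℕ) : Measure (LongEdge N → Bool) :=
  Measure.pi fun e : LongEdge N => bernoulliMeasure true false (edgeProb γ e)

/-- The normalizing constant of the Gibbs measure. -/
noncomputable def partition (γ b : ℝ) (p : ℝ≥0∞) (N : ℕ) : ℝ :=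
  ∫ g, Real.exp (-((N : ℝ) ^ b * avgPathLength p g)) ∂refMeasure γ N

lemma integral_edgeLaw_prod (γ : ℝ) (N : ℕ) (f : LongEdge N → Bool → ℝ) :
    ∫ ω, ∏ e, f e (ω e) ∂edgeLaw γ N =
      ∏ e : LongEdge N, (Real.exp (-((e.length : ℝ) ^ γ)) * f e true +
        (1 - Real.exp (-((e.length : ℝ) ^ γ))) * f e false) := by
  rw [integral_fintype_prod_eq_prod]
  refine Finset.prod_congr rfl fun e _ => ?_
  rw [integral_bernoulliMeasure]
  simp [edgeProb]

/-- The expectation is restricted to the event that all of `F` is present. Its probability is `exp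
(-∑ |e| ^ γ)` by independence, and the energy there is at most `N ^ b * D`. -/
lemma exp_le_partition {N : ℕ} (hN : 0 < N) (γ b : ℝ) (p : ℝ≥0∞) (hp : 1 ≤ p)
    (F : Finset (LongEdge N)) (D : ℝ)
    (hD : ∀ ω : LongEdge N → Bool, (∀ e ∈ F, ω e = true) →
      ∀ x y, (gdist (ofConfig ω) x y : ℝ) ≤ D) :
    Real.exp (-((N : ℝ) ^ b * D + ∑ e ∈ F, (e.length : ℝ) ^ γ)) ≤ partition γ b p N := by
  classical
  unfold partition refMeasure
  rw [integral_map (Measurable.of_discrete).aemeasurable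
    (Measurable.of_discrete).aestronglyMeasurable]
  have hprod : ∫ ω, ∏ e, (if e ∈ F then (if ω e = true then (1 : ℝ) else 0) else 1)
      ∂edgeLaw γ N = Real.exp (-∑ e ∈ F, (e.length : ℝ) ^ γ) := by
    rw [integral_edgeLaw_prod γ N
      (fun e t => if e ∈ F then (if t = true then (1 : ℝ) else 0) else 1),
      ← Finset.sum_neg_distrib, Real.exp_sum]
    rw [← Finset.prod_subset (Finset.subset_univ F)]
    · exact Finset.prod_congr rfl fun e he => by simp [he]
    · intro e _ he; simp [he]
  rw [neg_add, Real.exp_add, ← hprod, ← integral_const_mul]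
  refine integral_mono Integrable.of_finite Integrable.of_finite fun ω => ?_
  dsimp only
  by_cases h : ∀ e ∈ F, ω e = true
  · rw [Finset.prod_eq_one (fun e _ => by
      split_ifs with he h'
      · rfl
      · exact absurd (h e he) h'
      · rfl), mul_one]
    refine Real.exp_le_exp.2 (neg_le_neg ?_)
    gcongr
    exact avgPathLength_le hN p hp _ D (hD ω h)
  · push Not at h
    obtain ⟨e, he, hω⟩ := h
    rw [Finset.prod_eq_zero (Finset.mem_univ e) (by simp [he, hω]), mul_zero]
    positivity

/-- Exponential Chebyshev bound for the cost of the present edges of length at least `R`. -/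
lemma edgeLaw_cost_le (γ : ℝ) (hγ : 0 < γ) (N : ℕ) (R M : ℝ) (hR : 0 ≤ R) :
    (edgeLaw γ N).real {ω | M ≤ ∑ e ∈ edgesFrom ω R, (e.length : ℝ) ^ γ} ≤
      Real.exp (-(M / 2) + (N : ℝ) ^ 2 * Real.exp (-(R ^ γ / 2))) := by
  classical
  set μ := edgeLaw γ N
  -- Tilting by half of the cost leaves a spare factor `exp (-|e| ^ γ / 2)`: each edge contributes
  -- at most `1 + exp (-R ^ γ / 2)` to the exponential moment, and there are at most `N ^ 2` edges.
  set f : LongEdge N → Bool → ℝ := fun e t =>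
    if t = true ∧ R ≤ e.length then Real.exp ((e.length : ℝ) ^ γ / 2) else 1 with hf
  have hfprod : ∀ ω : LongEdge N → Bool,
      ∏ e, f e (ω e) = Real.exp ((∑ e ∈ edgesFrom ω R, (e.length : ℝ) ^ γ) / 2) := by
    intro ω
    rw [Finset.sum_div, Real.exp_sum, edgesFrom, Finset.prod_filter]
  have hint : ∫ ω, ∏ e, f e (ω e) ∂μ ≤ Real.exp ((N : ℝ) ^ 2 * Real.exp (-(R ^ γ / 2))) := by
    rw [integral_edgeLaw_prod]
    calc _ ≤ ∏ e : LongEdge N, Real.exp (Real.exp (-(R ^ γ / 2))) := by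
          refine Finset.prod_le_prod (fun e _ => ?_) fun e _ => ?_
          · have h1 : Real.exp (-((e.length : ℝ) ^ γ)) ≤ 1 :=
              Real.exp_le_one_iff.2 (neg_nonpos.2 (by positivity))
            have h2 : 0 ≤ f e true := by simp only [hf]; split_ifs <;> positivity
            have h3 : 0 ≤ f e false := by simp [hf]
            have h4 := Real.exp_nonneg (-((e.length : ℝ) ^ γ))
            have := sub_nonneg.2 h1
            positivity
          · by_cases h : R ≤ e.length
            · have h0 : f e false = 1 := by simp [hf]
              have h1 : f e true = Real.exp ((e.length : ℝ) ^ γ / 2) := by simp [hf, h]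
              rw [h0, h1, ← Real.exp_add]
              have h2 : Real.exp (-((e.length : ℝ) ^ γ) + (e.length : ℝ) ^ γ / 2) ≤
                  Real.exp (-(R ^ γ / 2)) := by
                refine Real.exp_le_exp.2 ?_
                have := Real.rpow_le_rpow hR h hγ.le
                linarith
              have h3 := Real.add_one_le_exp (Real.exp (-(R ^ γ / 2)))
              have h4 := Real.exp_nonneg (-((e.length : ℝ) ^ γ))
              linarith
            · simp [hf, h]; positivity
      _ ≤ _ := by
          rw [Finset.prod_const, ← Real.exp_nat_mul]
          refine Real.exp_le_exp.2 ?_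
          gcongr
          have : Fintype.card (LongEdge N) ≤ Fintype.card (Fin N × Fin N) :=
            Fintype.card_subtype_le _
          rw [Fintype.card_prod, Fintype.card_fin] at this
          rw [Finset.card_univ, pow_two]
          exact_mod_cast this
  have hmarkov := mul_meas_ge_le_integral_of_nonneg (μ := μ)
    (f := fun ω => Real.exp ((∑ e ∈ edgesFrom ω R, (e.length : ℝ) ^ γ) / 2))
    (Filter.Eventually.of_forall fun ω => (Real.exp_pos _).le) Integrable.of_finite
    (Real.exp (M / 2))
  have hset : {ω : LongEdge N → Bool | Real.exp (M / 2) ≤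
      Real.exp ((∑ e ∈ edgesFrom ω R, (e.length : ℝ) ^ γ) / 2)} =
      {ω | M ≤ ∑ e ∈ edgesFrom ω R, (e.length : ℝ) ^ γ} := by
    ext ω
    simp only [Set.mem_ofPred_eq, Real.exp_le_exp]
    constructor <;> intro h <;> linarith
  rw [hset] at hmarkov
  simp_rw [← hfprod] at hmarkov
  rw [Real.exp_add, Real.exp_neg, inv_mul_eq_div, le_div_iff₀ (Real.exp_pos _), mul_comm]
  exact hmarkov.trans hint

lemma partition_pos (γ b : ℝ) (p : ℝ≥0∞) (N : ℕ) : 0 < partition γ b p N :=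
  integral_exp_pos Integrable.of_finite

/-- A Gibbs probability is bounded by the reference probability times the largest density. -/
lemma gibbsMeasure_le (γ b : ℝ) (p : ℝ≥0∞) (N : ℕ) (A : Set (GroundedGraph N)) (h z r : ℝ)
    (hh : ∀ g ∈ A, h ≤ avgPathLength p g) (hz : Real.exp (-z) ≤ partition γ b p N)
    (hr : (refMeasure γ N).real A ≤ Real.exp r) :
    gibbsMeasure γ b p N A ≤ ENNReal.ofReal (Real.exp (z + r - (N : ℝ) ^ b * h)) := by
  have hZ := partition_pos γ b p N
  unfold gibbsMeasure
  rw [tilted_apply' _ _ (MeasurableSet.of_discrete)]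
  change ∫⁻ a in A, ENNReal.ofReal
    (Real.exp (-((N : ℝ) ^ b * avgPathLength p a)) / partition γ b p N) ∂refMeasure γ N ≤ _
  calc _ ≤ ∫⁻ a in A, ENNReal.ofReal (Real.exp (z - (N : ℝ) ^ b * h)) ∂refMeasure γ N := by
        refine setLIntegral_mono' (MeasurableSet.of_discrete) fun g hg => ?_
        refine ENNReal.ofReal_le_ofReal ?_
        rw [div_le_iff₀ hZ]
        calc Real.exp (-((N : ℝ) ^ b * avgPathLength p g))
            ≤ Real.exp (z - (N : ℝ) ^ b * h + -z) := by
              refine Real.exp_le_exp.2 ?_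
              have : (N : ℝ) ^ b * h ≤ (N : ℝ) ^ b * avgPathLength p g := by
                gcongr; exact hh g hg
              linarith
          _ ≤ _ := by rw [Real.exp_add]; gcongr
    _ = ENNReal.ofReal (Real.exp (z - (N : ℝ) ^ b * h) * (refMeasure γ N).real A) := by
        rw [setLIntegral_const, ENNReal.ofReal_mul (Real.exp_pos _).le, measureReal_def,
          ENNReal.ofReal_toReal (measure_ne_top _ _)]
    _ ≤ _ := by
        refine ENNReal.ofReal_le_ofReal ?_
        calc _ ≤ Real.exp (z - (N : ℝ) ^ b * h) * Real.exp r := by gcongr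
          _ = _ := by rw [← Real.exp_add]; ring_nf

/-- If the event `A` forces a cost `M` of the long edges, its reference probability is small. -/
lemma refMeasure_le (γ : ℝ) (hγ : 0 < γ) (N : ℕ) (R M : ℝ) (hR : 0 ≤ R)
    (A : Set (GroundedGraph N))
    (hA : ∀ ω, ofConfig ω ∈ A → M ≤ ∑ e ∈ edgesFrom ω R, (e.length : ℝ) ^ γ) :
    (refMeasure γ N).real A ≤
      Real.exp (-(M / 2) + (N : ℝ) ^ 2 * Real.exp (-(R ^ γ / 2))) := by
  refine le_trans ?_ (edgeLaw_cost_le γ hγ N R M hR)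
  unfold refMeasure
  rw [map_measureReal_apply Measurable.of_discrete MeasurableSet.of_discrete]
  exact measureReal_mono hA

/-! ### The cost exponent and its balance with the energy -/

open Filter Topology

/-- Up to constants and logarithms, graphs of average path length `N ^ a` have reference probability
`exp (- N ^ costExponent γ a)`. -/
noncomputable def costExponent (γ a : ℝ) : ℝ :=
  if γ < 1 then 1 - a * (1 - γ) else a + (1 - a) * γ

lemma alpha_nonneg (γ b : ℝ) : 0 ≤ alpha γ b := by
  unfold alpha; split_ifs <;> exact le_max_right _ _

lemma alpha_le_one (γ b : ℝ) : alpha γ b ≤ 1 := by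
  unfold alpha; split_ifs <;> exact max_le (min_le_right _ _) zero_le_one

/-- The untruncated exponent `u` solves `costExponent γ u = b + u`. If `alpha γ b < 1`, only the
truncation at `0` can act; it moves the point to the right of `u`, where the energy exponent
dominates. -/
lemma costExponent_alpha_le (γ b : ℝ) (hγ : 0 < γ) (h : alpha γ b < 1) :
    costExponent γ (alpha γ b) ≤ b + alpha γ b := by
  unfold costExponent
  unfold alpha at h ⊢
  split_ifs at h ⊢ with h1
  · have h2 : 0 < 2 - γ := by linarith
    set u := (1 - b) / (2 - γ) with hu
    have hu' : u * (2 - γ) = 1 - b := div_mul_cancel₀ _ h2.ne'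
    have hu1 : u < 1 := by
      by_contra hc
      rw [min_eq_right (not_lt.1 hc), max_eq_left zero_le_one] at h
      exact lt_irrefl _ h
    rw [min_eq_left hu1.le]
    have := le_max_left u 0
    nlinarith
  · set u := (γ - b) / γ with hu
    have hu' : u * γ = γ - b := div_mul_cancel₀ _ hγ.ne'
    have hu1 : u < 1 := by
      by_contra hc
      rw [min_eq_right (not_lt.1 hc), max_eq_left zero_le_one] at h
      exact lt_irrefl _ h
    rw [min_eq_left hu1.le]
    have := le_max_left u 0
    nlinarith

/-- Mirror image of `costExponent_alpha_le`: only the truncation at `1` can act, moving the point to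
the left of `u`, where the cost exponent dominates. -/
lemma le_costExponent_alpha (γ b : ℝ) (hγ : 0 < γ) (h : 0 < alpha γ b) :
    b + alpha γ b ≤ costExponent γ (alpha γ b) := by
  unfold costExponent
  unfold alpha at h ⊢
  split_ifs at h ⊢ with h1
  · have h2 : 0 < 2 - γ := by linarith
    set u := (1 - b) / (2 - γ) with hu
    have hu' : u * (2 - γ) = 1 - b := div_mul_cancel₀ _ h2.ne'
    have hm : 0 < min u 1 := by simpa using h
    rw [max_eq_left hm.le]
    have := min_le_left u 1
    nlinarith
  · set u := (γ - b) / γ with hu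
    have hu' : u * γ = γ - b := div_mul_cancel₀ _ hγ.ne'
    have hm : 0 < min u 1 := by simpa using h
    rw [max_eq_left hm.le]
    have := min_le_left u 1
    nlinarith

/-- For `γ = 1` the exponent would be constantly `1`, and no scale would be distinguished by its
cost. -/
lemma costExponent_strictAnti (γ : ℝ) (hγ1 : γ ≠ 1) : StrictAnti (costExponent γ) := by
  intro a a' h
  unfold costExponent
  split_ifs with h1
  · nlinarith
  · have : 1 < γ := lt_of_le_of_ne (not_lt.1 h1) hγ1.symm
    nlinarith

lemma costExponent_pos (γ a : ℝ) (hγ : 0 < γ) (ha : a ≤ 1) :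
    0 < costExponent γ a := by
  unfold costExponent
  split_ifs <;> nlinarith

/-! ### Growth of powers -/

lemma tendsto_natCast_rpow {s : ℝ} (hs : 0 < s) :
    Tendsto (fun N : ℕ => (N : ℝ) ^ s) atTop atTop :=
  (tendsto_rpow_atTop hs).comp tendsto_natCast_atTop_atTop

lemma eventually_rpow_le {s t c : ℝ} (hst : t < s) (hc : 0 < c) :
    ∀ᶠ N : ℕ in atTop, (N : ℝ) ^ t ≤ c * (N : ℝ) ^ s := by
  filter_upwards [(tendsto_natCast_rpow (sub_pos.2 hst)).eventually_ge_atTop (1 / c),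
    eventually_gt_atTop 0] with N h1 h2
  have hN : (0 : ℝ) < N := by exact_mod_cast h2
  rw [Real.rpow_sub hN, div_le_div_iff₀ hc (by positivity)] at h1
  linarith

lemma tendsto_rpow_sub_rpow {s t c : ℝ} (hst : t < s) (hs : 0 < s) (hc : 0 < c) :
    Tendsto (fun N : ℕ => c * (N : ℝ) ^ s - (N : ℝ) ^ t) atTop atTop := by
  refine tendsto_atTop_mono' atTop ?_ ((tendsto_natCast_rpow hs).const_mul_atTop (half_pos hc))
  filter_upwards [eventually_rpow_le hst (half_pos hc)] with N h
  linarith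

/-- This absorbs the number of dyadic levels into an arbitrarily small power. -/
lemma eventually_log_mul_le {η : ℝ} (hη : 0 < η) (c : ℝ) (hc : 0 < c) :
    ∀ᶠ N : ℕ in atTop, c * ((Nat.log 2 N : ℝ) + 1) ≤ (N : ℝ) ^ η := by
  have h1 : ∀ᶠ x : ℝ in atTop, Real.log x ≤ (Real.log 2 / (2 * c)) * x ^ η := by
    filter_upwards [(isLittleO_log_rpow_atTop hη).bound
      (show 0 < Real.log 2 / (2 * c) by have := Real.log_pos one_lt_two; positivity),
      eventually_ge_atTop 0] with x hx hx0
    rw [Real.norm_of_nonneg (show 0 ≤ x ^ η by positivity)] at hx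
    exact (le_abs_self _).trans hx
  filter_upwards [tendsto_natCast_atTop_atTop.eventually h1,
    (tendsto_natCast_rpow hη).eventually_ge_atTop (2 * c), eventually_gt_atTop 0] with N h1 h2 h3
  have hl2 := Real.log_pos one_lt_two
  have h4 : (Nat.log 2 N : ℝ) * Real.log 2 ≤ Real.log N := by
    rw [← Real.log_pow]
    refine Real.log_le_log (by positivity) ?_
    exact_mod_cast Nat.pow_log_le_self 2 h3.ne'
  have h5 : (Nat.log 2 N : ℝ) ≤ (N : ℝ) ^ η / (2 * c) := by
    have := h4.trans h1
    rw [div_mul_eq_mul_div, mul_div_assoc, mul_comm] at this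
    exact le_of_mul_le_mul_left this hl2
  rw [le_div_iff₀ (by positivity)] at h5
  linarith

/-! ### Lower bound on the normalizing constant -/

lemma exists_two_pow_le (x : ℝ) (hx : 1 ≤ x) (N : ℕ) (hxN : x ≤ N) :
    ∃ k ≤ Nat.log 2 N, (2 : ℝ) ^ k ≤ x ∧ x ≤ 2 * 2 ^ k := by
  have hf : ⌊x⌋₊ ≠ 0 := (Nat.floor_pos.2 hx).ne'
  refine ⟨Nat.log 2 ⌊x⌋₊, Nat.log_mono_right ?_, ?_, ?_⟩
  · exact_mod_cast (Nat.floor_le (by linarith)).trans hxN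
  · refine le_trans ?_ (Nat.floor_le (by linarith))
    exact_mod_cast Nat.pow_log_le_self 2 hf
  · have h1 := Nat.lt_pow_succ_log_self (b := 2) one_lt_two ⌊x⌋₊
    have h2 : ((⌊x⌋₊ + 1 : ℕ) : ℝ) ≤ (2 ^ (Nat.log 2 ⌊x⌋₊ + 1) : ℕ) := by exact_mod_cast h1
    push_cast at h2
    rw [pow_succ] at h2
    linarith [Nat.lt_floor_add_one x]

/-- The choice of the dyadic levels. -/
lemma exists_levels (γ a : ℝ) (hγ : 0 < γ) (ha0 : 0 ≤ a) (ha1 : a ≤ 1) (N : ℕ) (hN : 1 ≤ N) :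
    ∃ K₁ K₂ : ℕ, K₁ ≤ K₂ ∧ K₂ ≤ Nat.log 2 N ∧
      (2 : ℝ) ^ K₁ + (N : ℝ) / 2 ^ K₂ ≤ 3 * (N : ℝ) ^ a ∧
      ∀ k, K₁ ≤ k → k ≤ K₂ → ((2 : ℝ) ^ k) ^ (γ - 1) ≤ 2 * (N : ℝ) ^ (costExponent γ a - 1) := by
  have hN1 : (1 : ℝ) ≤ N := by exact_mod_cast hN
  have hN0 : (0 : ℝ) < N := by linarith
  have hpow : ∀ s : ℝ, 0 ≤ s → s ≤ 1 → 1 ≤ (N : ℝ) ^ s ∧ (N : ℝ) ^ s ≤ N := fun s h0 h1 =>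
    ⟨Real.one_le_rpow hN1 h0, by simpa using Real.rpow_le_rpow_of_exponent_le hN1 h1⟩
  by_cases h1 : γ < 1
  -- For `γ < 1` the shortest level is the most expensive, so the levels start near `N ^ a` and go
  -- up to `Nat.log 2 N`, where at most two hops remain.
  · obtain ⟨K, hK, hKle, hKge⟩ := exists_two_pow_le _ (hpow a ha0 ha1).1 N (hpow a ha0 ha1).2
    have hNge : (N : ℝ) ≤ 2 * 2 ^ Nat.log 2 N := by
      have := Nat.lt_pow_succ_log_self (b := 2) one_lt_two N
      have h2 : (N : ℝ) ≤ (2 ^ (Nat.log 2 N + 1) : ℕ) := by exact_mod_cast this.le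
      push_cast at h2
      rw [pow_succ] at h2
      linarith
    refine ⟨K, Nat.log 2 N, hK, le_rfl, ?_, fun k hk _ => ?_⟩
    · have : (N : ℝ) / 2 ^ Nat.log 2 N ≤ 2 := by rw [div_le_iff₀ (by positivity)]; exact hNge
      linarith [(hpow a ha0 ha1).1]
    · have hkK : (2 : ℝ) ^ K ≤ 2 ^ k := pow_le_pow_right₀ one_le_two hk
      have hexp : costExponent γ a - 1 = a * (γ - 1) := by
        unfold costExponent; rw [if_pos h1]; ring
      calc ((2 : ℝ) ^ k) ^ (γ - 1) ≤ ((N : ℝ) ^ a / 2) ^ (γ - 1) :=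
            Real.rpow_le_rpow_of_nonpos (by positivity) (by linarith) (by linarith)
        _ = (2 : ℝ) ^ (1 - γ) * (N : ℝ) ^ (costExponent γ a - 1) := by
            rw [Real.div_rpow (by positivity) (by norm_num), ← Real.rpow_mul hN0.le, hexp,
              show 1 - γ = -(γ - 1) by ring, Real.rpow_neg (by norm_num : (0 : ℝ) ≤ 2)]
            ring
        _ ≤ _ := by
            gcongr
            simpa using Real.rpow_le_rpow_of_exponent_le one_le_two (show 1 - γ ≤ 1 by linarith)
  -- Here the longest level is the most expensive, so the levels start at the ground and stop near
  -- `N ^ (1 - a)`, leaving at most `2 * N ^ a` hops.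
  · push Not at h1
    have h := hpow (1 - a) (by linarith) (by linarith)
    obtain ⟨K, hK, hKle, hKge⟩ := exists_two_pow_le _ h.1 N h.2
    refine ⟨0, K, Nat.zero_le _, hK, ?_, fun k _ hk => ?_⟩
    · have : (N : ℝ) / 2 ^ K ≤ 2 * (N : ℝ) ^ a := by
        rw [div_le_iff₀ (by positivity)]
        calc (N : ℝ) = (N : ℝ) ^ a * (N : ℝ) ^ (1 - a) := by
              rw [← Real.rpow_add hN0]; simp
          _ ≤ (N : ℝ) ^ a * (2 * 2 ^ K) := by gcongr
          _ = _ := by ring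
      simp only [pow_zero]
      linarith [(hpow a ha0 ha1).1]
    · have hkK : (2 : ℝ) ^ k ≤ 2 ^ K := pow_le_pow_right₀ one_le_two hk
      have hexp : costExponent γ a - 1 = (1 - a) * (γ - 1) := by
        unfold costExponent; rw [if_neg (not_lt.2 h1)]; ring
      calc ((2 : ℝ) ^ k) ^ (γ - 1) ≤ ((N : ℝ) ^ (1 - a)) ^ (γ - 1) :=
            Real.rpow_le_rpow (by positivity) (hkK.trans hKle) (by linarith)
        _ = (N : ℝ) ^ (costExponent γ a - 1) := by rw [← Real.rpow_mul hN0.le, hexp]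
        _ ≤ _ := by linarith [show 0 ≤ (N : ℝ) ^ (costExponent γ a - 1) by positivity]

/-- If `alpha γ b = 1`, no edge is forced and the ground path bounds the diameter by `N`. Otherwise
the dyadic edges at scale `N ^ alpha γ b` make both energy and cost at most `N ^ (b + alpha γ b)` up
to a logarithm, which `η` absorbs. -/
lemma eventually_exp_le_partition (γ b : ℝ) (hγ : 0 < γ) (p : ℝ≥0∞) (hp : 1 ≤ p) (η : ℝ)
    (hη : 0 < η) :
    ∀ᶠ N : ℕ in atTop, Real.exp (-(N : ℝ) ^ (b + alpha γ b + η)) ≤ partition γ b p N := by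
  rcases (alpha_le_one γ b).eq_or_lt with h | h
  · filter_upwards [eventually_ge_atTop 1] with N hN
    have hN1 : (1 : ℝ) ≤ N := by exact_mod_cast hN
    refine le_trans ?_ (exp_le_partition (by omega) γ b p hp ∅ N
      fun ω _ x y => by exact_mod_cast gdist_le _ x y)
    refine Real.exp_le_exp.2 (neg_le_neg ?_)
    rw [Finset.sum_empty, add_zero, h, ← Real.rpow_add_one (by positivity)]
    exact Real.rpow_le_rpow_of_exponent_le hN1 (by linarith)
  · set a := alpha γ b
    have hcost := costExponent_alpha_le γ b hγ h
    filter_upwards [eventually_ge_atTop 1, eventually_log_mul_le hη 10 (by norm_num)] with N hN hlog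
    have hN1 : (1 : ℝ) ≤ N := by exact_mod_cast hN
    have hN0 : (0 : ℝ) < N := by linarith
    obtain ⟨K₁, K₂, hK, hK₂, hdist, hB⟩ :=
      exists_levels γ a hγ (alpha_nonneg γ b) h.le N hN
    refine le_trans ?_ (exp_le_partition (by omega) γ b p hp (dyadicEdges N K₁ K₂)
      (2 * (3 * (N : ℝ) ^ a + K₂)) fun ω hω x y => ?_)
    · refine Real.exp_le_exp.2 (neg_le_neg ?_)
      have hsum := sum_dyadicEdges_le N K₁ K₂ γ _ hK hB
      have hK₂' : (K₂ : ℝ) ≤ Nat.log 2 N := by exact_mod_cast hK₂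
      have ha : 1 ≤ (N : ℝ) ^ a := Real.one_le_rpow hN1 (alpha_nonneg γ b)
      have hK0 : (0 : ℝ) ≤ K₂ := by positivity
      have h1 : 2 * (3 * (N : ℝ) ^ a + K₂) ≤ 8 * (K₂ + 1) * (N : ℝ) ^ a := by nlinarith
      have h2 : (N : ℝ) * (2 * (N : ℝ) ^ (costExponent γ a - 1)) ≤ 2 * (N : ℝ) ^ (b + a) := by
        rw [Real.rpow_sub_one hN0.ne']
        calc _ = 2 * (N : ℝ) ^ costExponent γ a := by field_simp
          _ ≤ _ := by gcongr
      calc _ ≤ (N : ℝ) ^ b * (8 * (K₂ + 1) * (N : ℝ) ^ a) +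
              (K₂ + 1) * (2 * (N : ℝ) ^ (b + a)) := by
            refine add_le_add ?_ (hsum.trans ?_) <;> gcongr
        _ = 10 * (K₂ + 1) * (N : ℝ) ^ (b + a) := by rw [Real.rpow_add hN0]; ring
        _ ≤ (N : ℝ) ^ η * (N : ℝ) ^ (b + a) := by
            gcongr
            exact le_trans (by gcongr) hlog
        _ = _ := by rw [← Real.rpow_add hN0]; ring_nf
    · have h1 := gdist_le_of_dyadic hω hK x y
      have h2 : (gdist (ofConfig ω) x y : ℝ) ≤ 2 * (2 ^ K₁ + K₂ + (N / 2 ^ K₂ : ℕ)) := by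
        exact_mod_cast h1
      have h3 : ((N / 2 ^ K₂ : ℕ) : ℝ) ≤ N / 2 ^ K₂ := by exact_mod_cast Nat.cast_div_le
      linarith

/-! ### Cost of short average distances -/

lemma edgesBetween_subset {N : ℕ} (ω : LongEdge N → Bool) (R S : ℝ) :
    edgesBetween ω R S ⊆ edgesFrom ω R := fun e he => by
  simp only [edgesBetween, edgesFrom, Finset.mem_filter] at he ⊢
  exact ⟨he.1, he.2.1, he.2.2.1⟩

/-- Writing `|e| = |e| ^ (1 - γ) * |e| ^ γ` turns covered length into cost. In applications `B`
comes from the upper end `S` when `γ < 1` and from the lower end `R` when `γ > 1`. -/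
lemma sum_length_le {N : ℕ} (ω : LongEdge N → Bool) (γ R S B : ℝ) (hB0 : 0 ≤ B)
    (hB : ∀ e ∈ edgesBetween ω R S, (e.length : ℝ) ^ (1 - γ) ≤ B) :
    ∑ e ∈ edgesBetween ω R S, (e.length : ℝ) ≤
      B * ∑ e ∈ edgesFrom ω R, (e.length : ℝ) ^ γ := by
  calc ∑ e ∈ edgesBetween ω R S, (e.length : ℝ)
      ≤ ∑ e ∈ edgesBetween ω R S, B * (e.length : ℝ) ^ γ := by
        refine Finset.sum_le_sum fun e he => ?_
        have hpos : (0 : ℝ) < e.length := by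
          have := e.2
          exact_mod_cast (show 0 < e.length by unfold LongEdge.length; omega)
        calc (e.length : ℝ) = (e.length : ℝ) ^ (1 - γ) * (e.length : ℝ) ^ γ := by
              rw [← Real.rpow_add hpos]; simp
          _ ≤ _ := by gcongr; exact hB e he
    _ ≤ ∑ e ∈ edgesFrom ω R, B * (e.length : ℝ) ^ γ :=
        Finset.sum_le_sum_of_subset_of_nonneg (edgesBetween_subset ω R S)
          fun _ _ _ => by positivity
    _ = _ := by rw [Finset.mul_sum]

lemma half_le_of_avgPathLength_le {N : ℕ} (hN : 0 < N) (p : ℝ≥0∞) (hp : 1 ≤ p)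
    (ω : LongEdge N → Bool) (R S h : ℝ) (hR : 1 ≤ R) (hh : 0 < h)
    (hle : avgPathLength p (ofConfig ω) ≤ h) :
    (N : ℝ) / 2 ≤ ∑ e ∈ edgesBetween ω R S, (e.length : ℝ) +
      (2 * (edgesFrom ω S).card + 1) * (4 * (h * R) + 1) := by
  have hN' : (0 : ℝ) < N := by exact_mod_cast hN
  have h1 := (mean_le_avgPathLength hN p hp (ofConfig ω)).trans hle
  rw [one_div, inv_mul_le_iff₀ (by positivity)] at h1
  obtain ⟨x, hx⟩ := exists_half_ball hN _ h hh h1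
  refine hx.trans ((ball_card_le ω R S (2 * h) hR (by positivity) x).trans ?_)
  ring_nf
  rfl

/-- With `R` and `S` chosen so that the uncovered part of the ball is too small, intermediate edges
must cover a positive fraction of the path or, when `γ < 1`, the edges of length at least `S` must
be numerous; each alternative is costly. The threshold is a positive power `N ^ ρ` so that the error
`N ^ 2 * exp (-R ^ γ / 2)` in the moment bound vanishes. -/
lemma eventually_cost_ge (γ : ℝ) (hγ : 0 < γ) (hγ1 : γ ≠ 1) (p : ℝ≥0∞) (hp : 1 ≤ p) (a κ : ℝ)
    (ha0 : 0 < a) (ha1 : a < 1) (hκ : κ < costExponent γ a) :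
    ∃ ρ : ℝ, 0 < ρ ∧ ∀ᶠ N : ℕ in atTop, ∀ ω : LongEdge N → Bool,
      avgPathLength p (ofConfig ω) ≤ (N : ℝ) ^ a →
        (N : ℝ) ^ κ / 44 ≤ ∑ e ∈ edgesFrom ω ((N : ℝ) ^ ρ), (e.length : ℝ) ^ γ := by
  unfold costExponent at hκ
  split_ifs at hκ with h1
  -- The choice `R = N ^ δ`, `S = N ^ (a + δ)` gives `N ^ a * R = S`; the slack `δ` makes `S`
  -- negligible against `N` while keeping the exponent at least `κ`.
  · obtain ⟨δ, hδ0, hδ⟩ : ∃ δ > 0, a + δ < 1 ∧ κ ≤ 1 - (a + δ) * (1 - γ) := by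
      have h2 : 0 < 1 - γ := by linarith
      refine ⟨min ((1 - a) / 2) ((1 - a * (1 - γ) - κ) / (1 - γ)), ?_, ?_, ?_⟩
      · have : 0 < 1 - a * (1 - γ) - κ := by linarith
        have : 0 < 1 - a := by linarith
        positivity
      · have := min_le_left ((1 - a) / 2) ((1 - a * (1 - γ) - κ) / (1 - γ))
        linarith
      · have := min_le_right ((1 - a) / 2) ((1 - a * (1 - γ) - κ) / (1 - γ))
        rw [le_div_iff₀ h2] at this
        linarith
    refine ⟨δ, hδ0, ?_⟩
    filter_upwards [eventually_ge_atTop 1, eventually_rpow_le (c := 1 / 20) hδ.1 (by norm_num)]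
      with N hN hS ω hω
    have hN1 : (1 : ℝ) ≤ N := by exact_mod_cast hN
    have hN0 : (0 : ℝ) < N := by linarith
    rw [Real.rpow_one] at hS
    set R := (N : ℝ) ^ δ with hRdef
    set S := (N : ℝ) ^ (a + δ) with hSdef
    set M := ∑ e ∈ edgesFrom ω R, (e.length : ℝ) ^ γ
    have hR1 : 1 ≤ R := Real.one_le_rpow hN1 hδ0.le
    have hS1 : 1 ≤ S := Real.one_le_rpow hN1 (by linarith)
    have hRS : R ≤ S := Real.rpow_le_rpow_of_exponent_le hN1 (by linarith)
    have hS0 : 0 < S := by linarith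
    have hhalf := half_le_of_avgPathLength_le (by omega) p hp ω R S _ hR1 (by positivity) hω
    rw [show (N : ℝ) ^ a * R = S by rw [hRdef, hSdef, Real.rpow_add hN0]] at hhalf
    have hbet : ∑ e ∈ edgesBetween ω R S, (e.length : ℝ) ≤ S ^ (1 - γ) * M := by
      refine sum_length_le ω γ R S _ (by positivity) fun e he => ?_
      have := (Finset.mem_filter.1 he).2.2.2
      exact Real.rpow_le_rpow (by positivity) this.le (by linarith)
    have hm : ((edgesFrom ω S).card : ℝ) * S ≤ S ^ (1 - γ) * M := by
      calc ((edgesFrom ω S).card : ℝ) * S = S ^ (1 - γ) * ((edgesFrom ω S).card * S ^ γ) := by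
            have : S = S ^ (1 - γ) * S ^ γ := by rw [← Real.rpow_add hS0]; simp
            nth_rewrite 2 [this]
            ring
        _ ≤ S ^ (1 - γ) * M := by
            gcongr
            rw [← nsmul_eq_mul]
            refine (Finset.card_nsmul_le_sum _ (fun e => (e.length : ℝ) ^ γ) _ fun e he => ?_).trans
              (Finset.sum_le_sum_of_subset_of_nonneg ?_ fun _ _ _ => by positivity)
            · exact Real.rpow_le_rpow hS0.le (Finset.mem_filter.1 he).2.2 hγ.le
            · intro e he
              simp only [edgesFrom, Finset.mem_filter] at he ⊢
              exact ⟨he.1, he.2.1, hRS.trans he.2.2⟩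
    -- Since `5 * S ≤ N / 4`, the half ball gives `N / 4 ≤ (1 + 10) * S ^ (1 - γ) * M`, whence the
    -- constant `44`.
    have hmain : (N : ℝ) / 44 ≤ S ^ (1 - γ) * M := by
      have h3 : (2 * ((edgesFrom ω S).card : ℝ) + 1) * (4 * S + 1) ≤
          (2 * ((edgesFrom ω S).card : ℝ) + 1) * (5 * S) := by gcongr; linarith
      nlinarith
    have hSinv : S ^ (1 - γ) * (N : ℝ) ^ (1 - (a + δ) * (1 - γ)) = N := by
      rw [hSdef, ← Real.rpow_mul hN0.le, ← Real.rpow_add hN0]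
      simp
    have hκ' : (N : ℝ) ^ κ ≤ (N : ℝ) ^ (1 - (a + δ) * (1 - γ)) :=
      Real.rpow_le_rpow_of_exponent_le hN1 hδ.2
    refine le_of_mul_le_mul_left ?_ (show 0 < S ^ (1 - γ) by positivity)
    refine le_trans ?_ hmain
    rw [← mul_div_assoc]
    gcongr
    exact (mul_le_mul_of_nonneg_left hκ' (by positivity)).trans_eq hSinv
  · have hγ2 : 1 < γ := lt_of_le_of_ne (not_lt.1 h1) hγ1.symm
    obtain ⟨δ, hδ0, hδ⟩ : ∃ δ > 0, a + δ < 1 ∧ κ ≤ 1 + (1 - a - δ) * (γ - 1) := by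
      have h2 : 0 < γ - 1 := by linarith
      refine ⟨min ((1 - a) / 2) ((a + (1 - a) * γ - κ) / (γ - 1)), ?_, ?_, ?_⟩
      · have : 0 < a + (1 - a) * γ - κ := by linarith
        have : 0 < 1 - a := by linarith
        positivity
      · have := min_le_left ((1 - a) / 2) ((a + (1 - a) * γ - κ) / (γ - 1))
        linarith
      · have := min_le_right ((1 - a) / 2) ((a + (1 - a) * γ - κ) / (γ - 1))
        rw [le_div_iff₀ h2] at this
        linarith
    refine ⟨1 - a - δ, by linarith, ?_⟩
    filter_upwards [eventually_ge_atTop 1,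
      eventually_rpow_le (c := 1 / 20) (show 1 - δ < 1 by linarith) (by norm_num)]
      with N hN hT ω hω
    have hN1 : (1 : ℝ) ≤ N := by exact_mod_cast hN
    have hN0 : (0 : ℝ) < N := by linarith
    rw [Real.rpow_one] at hT
    set R := (N : ℝ) ^ (1 - a - δ) with hRdef
    set M := ∑ e ∈ edgesFrom ω R, (e.length : ℝ) ^ γ
    have hR1 : 1 ≤ R := Real.one_le_rpow hN1 (by linarith)
    have hR0 : 0 < R := by linarith
    have hhalf := half_le_of_avgPathLength_le (by omega) p hp ω R N _ hR1 (by positivity) hω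
    -- With `S = N` no edge is too long, so the only centre is that of the ball.
    have hempty : edgesFrom ω (N : ℝ) = ∅ := by
      refine Finset.filter_eq_empty_iff.2 fun e _ he => ?_
      have h2 : N ≤ e.length := by exact_mod_cast he.2
      have h3 := e.1.2.2
      unfold LongEdge.length at h2
      have := e.2
      omega
    rw [show (N : ℝ) ^ a * R = (N : ℝ) ^ (1 - δ) by
      rw [hRdef, ← Real.rpow_add hN0]; congr 1; ring, hempty] at hhalf
    simp only [Finset.card_empty, Nat.cast_zero, mul_zero, zero_add, one_mul] at hhalf
    have hbet : ∑ e ∈ edgesBetween ω R N, (e.length : ℝ) ≤ R ^ (1 - γ) * M := by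
      refine sum_length_le ω γ R N _ (by positivity) fun e he => ?_
      have := (Finset.mem_filter.1 he).2.2.1
      exact Real.rpow_le_rpow_of_nonpos hR0 this (by linarith)
    have hT1 : 1 ≤ (N : ℝ) ^ (1 - δ) := Real.one_le_rpow hN1 (by linarith)
    have hmain : (N : ℝ) / 44 ≤ R ^ (1 - γ) * M := by linarith
    have hRinv : R ^ (1 - γ) * (N : ℝ) ^ (1 + (1 - a - δ) * (γ - 1)) = N := by
      rw [hRdef, ← Real.rpow_mul hN0.le, ← Real.rpow_add hN0]
      ring_nf
      simp
    have hκ' : (N : ℝ) ^ κ ≤ (N : ℝ) ^ (1 + (1 - a - δ) * (γ - 1)) :=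
      Real.rpow_le_rpow_of_exponent_le hN1 hδ.2
    refine le_of_mul_le_mul_left ?_ (show 0 < R ^ (1 - γ) by positivity)
    refine le_trans ?_ hmain
    rw [← mul_div_assoc]
    gcongr
    exact (mul_le_mul_of_nonneg_left hκ' (by positivity)).trans_eq hRinv

/-! ### Tail bounds under the Gibbs measure -/

lemma tendsto_ofReal_exp_zero {f : ℕ → ℝ} (hf : Tendsto f atTop atTop) :
    Tendsto (fun N => ENNReal.ofReal (Real.exp (-f N))) atTop (𝓝 0) := by
  rw [← ENNReal.ofReal_zero]
  exact ENNReal.tendsto_ofReal (Real.tendsto_exp_neg_atTop_nhds_zero.comp hf)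

lemma tendsto_gibbs_upper (γ b : ℝ) (hγ : 0 < γ) (p : ℝ≥0∞) (hp : 1 ≤ p) (ε : ℝ) (hε : 0 < ε) :
    Tendsto (fun N : ℕ => gibbsMeasure γ b p N
      {g | (N : ℝ) ^ (alpha γ b + ε) < avgPathLength p g}) atTop (𝓝 0) := by
  rcases (alpha_le_one γ b).eq_or_lt with h | h
  · refine tendsto_const_nhds.congr' ?_
    filter_upwards [eventually_ge_atTop 1] with N hN
    have hN1 : (1 : ℝ) ≤ N := by exact_mod_cast hN
    have hempty : {g : GroundedGraph N | (N : ℝ) ^ (alpha γ b + ε) < avgPathLength p g} = ∅ := by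
      refine Set.eq_empty_of_forall_notMem fun g hg => ?_
      have h1 := avgPathLength_le (by omega) p hp g N fun x y => by exact_mod_cast gdist_le g x y
      have h2 : (N : ℝ) ^ (alpha γ b + ε) < avgPathLength p g := hg
      have h3 := Real.rpow_le_rpow_of_exponent_le hN1 (show 1 ≤ alpha γ b + ε by linarith)
      rw [Real.rpow_one] at h3
      linarith
    rw [hempty, measure_empty]
  -- When `alpha γ b < 1`, the energy exponent dominates the positive cost exponent, so the power in
  -- the Gibbs weight really diverges.
  · have hpos : 0 < b + alpha γ b + ε := by
      have h1 := costExponent_alpha_le γ b hγ h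
      have h2 := costExponent_pos γ _ hγ (alpha_le_one γ b)
      linarith
    refine tendsto_of_tendsto_of_tendsto_of_le_of_le' tendsto_const_nhds
      (tendsto_ofReal_exp_zero (tendsto_rpow_sub_rpow (c := 1)
        (show b + alpha γ b + ε / 2 < b + alpha γ b + ε by linarith) hpos one_pos))
      (Eventually.of_forall fun _ => zero_le) ?_
    filter_upwards [eventually_exp_le_partition γ b hγ p hp (ε / 2) (half_pos hε),
      eventually_ge_atTop 1] with N hZ hN
    have hN0 : (0 : ℝ) < N := by exact_mod_cast hN
    refine (gibbsMeasure_le γ b p N _ ((N : ℝ) ^ (alpha γ b + ε)) _ 0 (fun g hg => le_of_lt hg)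
      hZ (by simpa using measureReal_le_one)).trans_eq ?_
    rw [← Real.rpow_add hN0]
    ring_nf

lemma tendsto_gibbs_lower (γ b : ℝ) (hγ : 0 < γ) (hγ1 : γ ≠ 1) (p : ℝ≥0∞) (hp : 1 ≤ p) (ε : ℝ)
    (hε : 0 < ε) :
    Tendsto (fun N : ℕ => gibbsMeasure γ b p N
      {g | avgPathLength p g < (N : ℝ) ^ (alpha γ b - ε)}) atTop (𝓝 0) := by
  rcases (alpha_nonneg γ b).eq_or_lt with h | h
  · refine tendsto_const_nhds.congr' ?_
    filter_upwards [eventually_ge_atTop 2, (tendsto_natCast_rpow hε).eventually_ge_atTop 2]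
      with N hN hε2
    have hempty : {g : GroundedGraph N | avgPathLength p g < (N : ℝ) ^ (alpha γ b - ε)} = ∅ := by
      refine Set.eq_empty_of_forall_notMem fun g hg => ?_
      have h1 := half_le_avgPathLength hN p hp g
      have h2 : avgPathLength p g < (N : ℝ) ^ (alpha γ b - ε) := hg
      rw [← h, zero_sub, Real.rpow_neg (by positivity)] at h2
      have h3 : ((N : ℝ) ^ ε)⁻¹ ≤ 2⁻¹ := inv_anti₀ (by norm_num) hε2
      norm_num at h1 h3
      linarith
    rw [hempty, measure_empty]
  · set α := alpha γ b with hα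
    -- The cap `α / 2` keeps `a` positive; the event only shrinks if `ε` is larger.
    set a := α - min ε (α / 2) with ha
    have hmin : 0 < min ε (α / 2) := lt_min hε (half_pos h)
    have ha0 : 0 < a := by linarith [min_le_right ε (α / 2)]
    have haα : a < α := by linarith
    have ha1 : a < 1 := haα.trans_le (alpha_le_one γ b)
    have hcost : b + α < costExponent γ a :=
      (le_costExponent_alpha γ b hγ h).trans_lt (costExponent_strictAnti γ hγ1 haα)
    have hcost0 := costExponent_pos γ a hγ ha1.le
    -- The exponent `κ` must beat `b + α` from the normalizing constant, and must be positive since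
    -- `b + α` can be negative.
    obtain ⟨κ, hκ1, hκ2⟩ := exists_between (max_lt hcost hcost0)
    have hκb : b + α < κ := (le_max_left _ _).trans_lt hκ1
    have hκ0 : 0 < κ := (le_max_right _ _).trans_lt hκ1
    obtain ⟨ρ, hρ, hev⟩ := eventually_cost_ge γ hγ hγ1 p hp a κ ha0 ha1 hκ2
    have hlim : Tendsto (fun N : ℕ => (1 / 88 * (N : ℝ) ^ κ -
        (N : ℝ) ^ (b + α + (κ - (b + α)) / 2)) + -1) atTop atTop :=
      tendsto_atTop_add_const_right _ _ (tendsto_rpow_sub_rpow (by linarith) hκ0 (by norm_num))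
    refine tendsto_of_tendsto_of_tendsto_of_le_of_le' tendsto_const_nhds
      (tendsto_ofReal_exp_zero hlim) (Eventually.of_forall fun _ => zero_le) ?_
    have hsmall : ∀ᶠ N : ℕ in atTop,
        (N : ℝ) ^ 2 * Real.exp (-(((N : ℝ) ^ ρ) ^ γ / 2)) ≤ 1 := by
      have hργ : 0 < ρ * γ := mul_pos hρ hγ
      have h1 := (tendsto_rpow_mul_exp_neg_mul_atTop_nhds_zero (2 / (ρ * γ)) (1 / 2)
        (by norm_num)).comp (tendsto_natCast_rpow hργ)
      filter_upwards [h1.eventually (eventually_le_nhds zero_lt_one)] with N hN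
      simp only [Function.comp] at hN
      rw [← Real.rpow_mul (by positivity), mul_div_cancel₀ _ hργ.ne', Real.rpow_two] at hN
      rw [← Real.rpow_mul (by positivity)]
      rwa [show -((N : ℝ) ^ (ρ * γ) / 2) = -(1 / 2) * (N : ℝ) ^ (ρ * γ) by ring]
    filter_upwards [eventually_exp_le_partition γ b hγ p hp ((κ - (b + α)) / 2) (by linarith),
      eventually_ge_atTop 1, hev, hsmall] with N hZ hN hcostN hsm
    have hN1 : (1 : ℝ) ≤ N := by exact_mod_cast hN
    -- The energy is bounded below by `0` only: the smallness comes entirely from the reference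
    -- probability.
    refine (gibbsMeasure_le γ b p N _ 0 _ (-(N ^ κ / 44 / 2) + 1) (fun g _ => ?_) hZ ?_).trans_eq ?_
    · exact le_trans (by positivity) (mean_le_avgPathLength (by omega) p hp g)
    · refine (refMeasure_le γ hγ N ((N : ℝ) ^ ρ) ((N : ℝ) ^ κ / 44) (by positivity) _
        fun ω hω => hcostN ω ?_).trans (Real.exp_le_exp.2 (by linarith))
      have h2 : avgPathLength p (ofConfig ω) < (N : ℝ) ^ (α - ε) := hω
      exact h2.le.trans (Real.rpow_le_rpow_of_exponent_le hN1
        (by linarith [min_le_left ε (α / 2)]))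
    · congr 2
      rw [← hα]
      ring

end SpatialGibbs

/-- For `γ ∈ (0, ∞)` with `γ ≠ 1`, `b ∈ ℝ` and `p ∈ [1, ∞]`, the ratio `log H_p / log N` converges
to `α(γ, b)` in probability under the Gibbs measures, as `N` tends to infinity. -/
theorem theorem1 (γ : ℝ) (hγ : 0 < γ) (hγ1 : γ ≠ 1) (b : ℝ) (p : ℝ≥0∞) (hp : 1 ≤ p)
    (ε : ℝ) (hε : 0 < ε) :
    Filter.Tendsto
      (fun N : ℕ => SpatialGibbs.gibbsMeasure γ b p N
        {g | ε < |Real.log (SpatialGibbs.avgPathLength p g) / Real.log (N : ℝ)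
              - SpatialGibbs.alpha γ b|})
      Filter.atTop (nhds 0) := by
  have hsum := (SpatialGibbs.tendsto_gibbs_upper γ b hγ p hp ε hε).add
    (SpatialGibbs.tendsto_gibbs_lower γ b hγ hγ1 p hp ε hε)
  rw [add_zero] at hsum
  refine tendsto_of_tendsto_of_tendsto_of_le_of_le' tendsto_const_nhds hsum
    (Filter.Eventually.of_forall fun _ => zero_le) ?_
  filter_upwards [Filter.eventually_ge_atTop 2] with N hN
  refine (MeasureTheory.measure_mono ?_).trans (MeasureTheory.measure_union_le _ _)
  intro g hg
  have hN1 : (1 : ℝ) < N := by exact_mod_cast hN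
  have hN0 : (0 : ℝ) < N := by linarith
  have hlog := Real.log_pos hN1
  have hH : 0 < SpatialGibbs.avgPathLength p g :=
    lt_of_lt_of_le (by norm_num) (SpatialGibbs.half_le_avgPathLength hN p hp g)
  have hg' : ε < |Real.log (SpatialGibbs.avgPathLength p g) / Real.log (N : ℝ)
              - SpatialGibbs.alpha γ b| := hg
  rcases lt_abs.1 hg' with h | h
  · left
    change (N : ℝ) ^ _ < _
    rw [Real.rpow_lt_iff_lt_log hN0 hH, ← lt_div_iff₀ hlog]
    linarith
  · right
    change _ < (N : ℝ) ^ _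
    rw [Real.lt_rpow_iff_log_lt hH hN0, ← div_lt_iff₀ hlog]
    linarith
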